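/- All digraphs are finite, without loops or parallel arcs. Let $D$ be a digraph with $n$ vertices and let $2\le k\le n$. A (sub)digraph is strong if for every ordered pair $(u,v)$ of its vertices it contains a directed path from $u$ to $v$. For a set $S\subseteq V(D)$ with $|S|=k$, strong subgraphs $D_1,\dots,D_p$ of $D$, each containing $S$ in its vertex set, are called internally disjoint if $V(D_i)\cap V(D_j)=S$ and $A(D_i)\cap A(D_j)=\emptyset$ for all $1\le i<j\le p$. Let $\kappa_S(D)$ be the maximum number of internally disjoint strong subgraphs of $D$ containing $S$, and let $\kappa_k(D)=\min\{\kappa_S(D) : S\subseteq V(D),\ |S|=k\}$. Let $\overleftrightarrow{K}_n$ be the complete biorientation of the complete graph $K_n$, that is, the digraph with $n$ vertices in which, for any two distinct vertices $x,y$, both $(x,y)$ and $(y,x)$ are arcs. Then for all integers $2\le k\le n$, $$\kappa_k(\overleftrightarrow{K}_n)=\begin{cases} n-1, & k\notin\{4,6\},\\ n-2, & k\in\{4,6\}.\end{cases}$$ -/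

import Mathlib

/-- The complete biorientation of a graph: every edge `xy` is replaced by the two arcs
`(x, y)` and `(y, x)`. -/
def SimpleGraph.completeBiorientation {V : Type*} (G : SimpleGraph V) : Digraph V where
  Adj := G.Adj

namespace Digraph

/-- A subgraph of a digraph `D`: a set of vertices together with a set of arcs of `D`
whose ends lie in that set. -/
@[ext]
structure Subgraph {V : Type*} (D : Digraph V) where
  /-- The vertex set. -/
  verts : Set V
  /-- The arcs, as a relation. -/
  Adj : V → V → Prop
  /-- Every arc is an arc of `D`. -/
  adj_sub : ∀ {u v : V}, Adj u v → D.Adj u v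
  /-- The tail of an arc is a vertex of the subgraph. -/
  left_mem : ∀ {u v : V}, Adj u v → u ∈ verts
  /-- The head of an arc is a vertex of the subgraph. -/
  right_mem : ∀ {u v : V}, Adj u v → v ∈ verts

/-- The arc set of a subgraph. -/
def Subgraph.arcs {V : Type*} {D : Digraph V} (H : D.Subgraph) : Set (V × V) :=
  {a | H.Adj a.1 a.2}

/-- A subgraph is strong if it has a vertex and contains a (possibly empty) directed walk from
`u` to `v` for every ordered pair of its vertices. A single vertex is strong. -/
def Subgraph.IsStrong {V : Type*} {D : Digraph V} (H : D.Subgraph) : Prop :=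
  H.verts.Nonempty ∧ ∀ u ∈ H.verts, ∀ v ∈ H.verts, Relation.ReflTransGen H.Adj u v

/-- `H 0, …, H (p - 1)` are `S`-internally disjoint strong subgraphs containing `S`. -/
structure IsInternallyDisjointFamily {V : Type*} (D : Digraph V) (S : Finset V) {p : ℕ}
    (H : Fin p → D.Subgraph) : Prop where
  isStrong : ∀ i, (H i).IsStrong
  subset_verts : ∀ i, (S : Set V) ⊆ (H i).verts
  verts_inter : ∀ i j, i < j → (H i).verts ∩ (H j).verts = S
  arcs_inter : ∀ i j, i < j → (H i).arcs ∩ (H j).arcs = ∅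

/-- `κ_S(D)`: the maximum number of `S`-internally disjoint strong subgraphs of `D`
containing `S`. -/
noncomputable def strongSubgraphConnectivityOn {V : Type*} (D : Digraph V) (S : Finset V) : ℕ :=
  sSup {p : ℕ | ∃ H : Fin p → D.Subgraph, D.IsInternallyDisjointFamily S H}

/-- `κ_k(D)`: the minimum of `κ_S(D)` over all sets `S` of `k` vertices. -/
noncomputable def strongSubgraphConnectivity {V : Type*} (D : Digraph V) (k : ℕ) : ℕ :=
  sInf {m : ℕ | ∃ S : Finset V, S.card = k ∧ D.strongSubgraphConnectivityOn S = m}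

/-- The maximum defining `κ_S(D)` exists when `D` is finite and `S` has at least two vertices. -/
theorem isGreatest_strongSubgraphConnectivityOn {V : Type*} [Finite V] (D : Digraph V)
    (S : Finset V) (hS : 2 ≤ S.card) :
    IsGreatest {p : ℕ | ∃ H : Fin p → D.Subgraph, D.IsInternallyDisjointFamily S H}
      (D.strongSubgraphConnectivityOn S) := by
  have hb : BddAbove {p : ℕ | ∃ H : Fin p → D.Subgraph, D.IsInternallyDisjointFamily S H} := by
    refine ⟨Nat.card (Set (V × V)), ?_⟩
    rintro p ⟨H, hH⟩
    have hne : ∀ i, ((H i).arcs).Nonempty := by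
      intro i
      obtain ⟨u, hu, v, hv, huv⟩ := Finset.one_lt_card.1 hS
      have h := (hH.isStrong i).2 u (hH.subset_verts i hu) v (hH.subset_verts i hv)
      rcases Relation.ReflTransGen.cases_head h with h | ⟨w, hw, -⟩
      · exact absurd h huv
      · exact ⟨(u, w), hw⟩
    have hinj : Function.Injective fun i => (H i).arcs := by
      intro i j hij
      by_contra hne'
      rcases lt_or_gt_of_ne hne' with h | h
      · have := hH.arcs_inter i j h
        simp only at hij
        rw [← hij, Set.inter_self] at this
        exact (hne i).ne_empty this
      · have := hH.arcs_inter j i h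
        simp only at hij
        rw [hij, Set.inter_self] at this
        exact (hne j).ne_empty this
    simpa using Nat.card_le_card_of_injective _ hinj
  refine ⟨Nat.sSup_mem ⟨0, fun i => i.elim0, ?_⟩ hb, fun p hp => le_csSup hb hp⟩
  exact ⟨fun i => i.elim0, fun i => i.elim0, fun i => i.elim0, fun i => i.elim0⟩

/-- The minimum defining `κ_k(D)` exists when `D` has at least `k` vertices. -/
theorem isLeast_strongSubgraphConnectivity {V : Type*} [Fintype V] (D : Digraph V) (k : ℕ)
    (hk : k ≤ Fintype.card V) :
    IsLeast {m : ℕ | ∃ S : Finset V, S.card = k ∧ D.strongSubgraphConnectivityOn S = m}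
      (D.strongSubgraphConnectivity k) := by
  obtain ⟨S, -, hS⟩ := Finset.exists_subset_card_eq (s := (Finset.univ : Finset V)) hk
  exact ⟨Nat.sInf_mem ⟨_, S, hS, rfl⟩, fun m hm => Nat.sInf_le hm⟩

end Digraph

/-! Fix `S` with `k` vertices among `n`. A vertex of `S` has `n - 1` out-arcs and every subgraph of
a family uses at least one, so there are at most `n - 1` subgraphs. In the other direction, each of
the `n - k` vertices outside `S` is the centre of a bidirected star on `S`, and `m` arc-disjoint
Hamiltonian cycles of `S` raise the count to `n - k + m`.

If `n - 1` is attained, every subgraph has out-degree one on `S`, so those with vertex set exactly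
`S` are Hamiltonian cycles of `S`. The others own a private vertex outside `S`, so there are at most
`n - k` of them and at least `k - 1` cycles remain. Hence the value is `n - 1` exactly when the
complete digraph on `k` vertices splits into `k - 1` Hamiltonian cycles. By Tillson's theorem this
happens unless `k` is 4 or 6; in these cases `k - 2` disjoint cycles still exist, which gives `n -
2`.

The decompositions are explicit. For `k = 2r + 1`, Walecki's zigzag path on `ZMod (2r)`, closed
through `∞`, has pairwise distinct differences, so its translates are arc-disjoint
(`isHamiltonianPacking_zigzag`). For `k = 2r + 2 ≥ 8`, a Hamiltonian cycle through one more vertex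
takes one arc from each translate, and each translate repairs its loss by a detour through the new
vertex (`IsHamiltonianPacking.extend`). Orders 4 and 6 are excluded by exhaustive search. -/

/-! ### Hamiltonian cycles as successor maps, and packings of them -/

/-- A self-map is Hamiltonian if its functional digraph is strong. On a finite type this means
that the map is a cyclic permutation of the whole type. -/
def IsHamiltonianMap {V : Type*} (f : V → V) : Prop :=
  ∀ u v, Relation.ReflTransGen (fun a b => f a = b) u v

/-- A family of pairwise arc-disjoint Hamiltonian directed cycles of the complete digraph on `V`,
each given by its successor map. -/
structure IsHamiltonianPacking {ι V : Type*} (f : ι → V → V) : Prop where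
  hamiltonian : ∀ i, IsHamiltonianMap (f i)
  ne_self : ∀ i v, f i v ≠ v
  injective : ∀ v, Function.Injective fun i => f i v

namespace IsHamiltonianMap

variable {V W : Type*} {f : V → V}

theorem of_base (b : V) (h₁ : ∀ v, Relation.ReflTransGen (fun a b => f a = b) b v)
    (h₂ : ∀ v, Relation.ReflTransGen (fun a b => f a = b) v b) : IsHamiltonianMap f :=
  fun u v => (h₂ u).trans (h₁ v)

theorem conj (hf : IsHamiltonianMap f) (e : V ≃ W) :
    IsHamiltonianMap fun w => e (f (e.symm w)) := by
  intro u v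
  have : Relation.ReflTransGen (fun a b => e (f (e.symm a)) = b) (e (e.symm u)) (e (e.symm v)) :=
    Relation.ReflTransGen.lift (r := fun a b => f a = b) e
      (by rintro a b rfl; simp [Function.onFun])
      _ _ (hf (e.symm u) (e.symm v))
  simpa using this

theorem surjective [Nontrivial V] (hf : IsHamiltonianMap f) : Function.Surjective f := by
  intro v
  obtain ⟨u, hu⟩ := exists_ne v
  rcases (hf u v).cases_tail with h | ⟨c, -, hc⟩
  · exact absurd h.symm hu
  · exact ⟨c, hc⟩

theorem injective [Finite V] [Nontrivial V] (hf : IsHamiltonianMap f) : Function.Injective f :=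
  Finite.injective_iff_surjective.2 hf.surjective

/-- Subdividing one arc of a Hamiltonian cycle by a new vertex. -/
theorem insert [DecidableEq V] (hf : IsHamiltonianMap f) (u : V) :
    IsHamiltonianMap fun x : Option V =>
      x.elim (some (f u)) fun a => if a = u then none else some (f a) := by
  set g := fun x : Option V => x.elim (some (f u)) fun a => if a = u then none else some (f a)
  have key : ∀ a b, Relation.ReflTransGen (fun x y => g x = y) (some a) (some b) := by
    intro a b
    refine Relation.ReflTransGen.lift' some ?_ _ _ (hf a b)
    rintro c d rfl
    by_cases hc : c = u
    · subst hc
      exact (Relation.ReflTransGen.single (b := none) (by simp [g])).tail (by simp [g])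
    · exact .single (by simp [g, hc])
  refine of_base (some u) ?_ ?_
  · rintro (_ | v)
    · exact .single (by simp [g])
    · exact key _ _
  · rintro (_ | v)
    · exact .head (b := some (f u)) (by simp [g]) (key _ _)
    · exact key _ _

end IsHamiltonianMap

theorem IsHamiltonianPacking.congr {ι κ V W : Type*} {f : ι → V → V}
    (hf : IsHamiltonianPacking f) (e : V ≃ W) (d : κ ↪ ι) :
    IsHamiltonianPacking fun k w => e (f (d k) (e.symm w)) where
  hamiltonian k := (hf.hamiltonian _).conj e
  ne_self k w h := hf.ne_self (d k) (e.symm w) (e.injective (h.trans (by simp)))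
  injective w k l h := d.injective (hf.injective (e.symm w) (e.injective h))

/-- If a Hamiltonian cycle `h` through a new vertex uses exactly one arc of every cycle of a
packing, then subdividing these arcs and adding `h` gives a packing with one more cycle on one more
vertex. -/
theorem IsHamiltonianPacking.extend {ι V : Type*} [Finite V] [Nonempty V] [DecidableEq V]
    {f : ι → V → V} (hf : IsHamiltonianPacking f) {h : Option V → Option V}
    (hh : IsHamiltonianMap h) (hself : ∀ x, h x ≠ x) (u : ι → V)
    (hfu : ∀ i, h (some (u i)) = some (f i (u i)))
    (hsurj : ∀ a, h (some a) ≠ none → ∃ i, u i = a) :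
    IsHamiltonianPacking fun (i : Option ι) (x : Option V) => i.elim (h x) fun i =>
      x.elim (some (f i (u i))) fun a => if a = u i then none else some (f i a) where
  hamiltonian := by
    rintro (_ | i)
    · exact hh
    · exact (hf.hamiltonian i).insert (u i)
  ne_self := by
    rintro (_ | i) x
    · exact hself x
    · rcases x with _ | a
      · simp
      · by_cases ha : a = u i
        · simp [ha]
        · simpa [ha] using hf.ne_self i a
  injective := by
    have hinj := hh.injective
    have hu : ∀ i j, u i = u j → i = j := by
      intro i j hij
      have h₁ := hfu j
      rw [← hij, hfu, Option.some_inj] at h₁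
      exact hf.injective _ h₁
    -- `h` meets no subdivided cycle: equal heads at the new vertex contradict injectivity of `h`,
    -- at `u i` the heads lie on different sides of `none`, and elsewhere a common arc would be the
    -- arc taken from another cycle `j`, which is disjoint from cycle `i`.
    have key : ∀ i x, h x ≠ (x.elim (some (f i (u i))) fun a =>
        if a = u i then none else some (f i a)) := by
      rintro i (_ | a) H
      · exact absurd (hinj (H.trans (hfu i).symm)) (by simp)
      · by_cases ha : a = u i
        · subst ha
          simp [hfu] at H
        · simp only [Option.elim_some, ha, if_false] at H
          obtain ⟨j, rfl⟩ := hsurj a (by simp [H])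
          rw [hfu, Option.some_inj] at H
          exact ha (congrArg u (hf.injective _ H))
    rintro x (_ | i) (_ | j) H
    · rfl
    · exact absurd H (key j x)
    · exact absurd H.symm (key i x)
    · refine congrArg some ?_
      rcases x with _ | a
      · have : h (some (u i)) = h (some (u j)) := by rw [hfu, hfu]; exact H
        exact hu _ _ (Option.some_injective _ (hinj this))
      · simp only [Option.elim_some] at H
        by_cases hi : a = u i <;> by_cases hj : a = u j
        · exact hu _ _ (hi.symm.trans hj)
        · simp [hi, hi ▸ hj] at H
        · simp [hj, hj ▸ hi] at H
        · simp only [hi, hj, if_false, Option.some_inj] at H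
          exact hf.injective _ H

/-! ### Odd order: Walecki's zigzag cycles -/

section Zigzag

variable (r : ℕ)

/-- The successor of `x` on the path `0, 1, -1, 2, -2, …, r` in `ZMod (2 * r)`. -/
def zigzagNext (x : ZMod (2 * r)) : Option (ZMod (2 * r)) :=
  if x = r then none else if 0 < x.val ∧ x.val < r then some (-x) else some (1 - x)

/-- The successor map of the cycle `∞, s, s + 1, s - 1, s + 2, s - 2, …, s + r`, where `∞` is
`none`. -/
def zigzag (s : ZMod (2 * r)) (x : Option (ZMod (2 * r))) : Option (ZMod (2 * r)) :=
  x.elim (some s) fun a => (zigzagNext r (a - s)).map (· + s)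

variable {r}

theorem natCast_inj_of_lt {n i j : ℕ} (hi : i < n) (hj : j < n) :
    (i : ZMod n) = j ↔ i = j := by
  rw [ZMod.natCast_eq_natCast_iff', Nat.mod_eq_of_lt hi, Nat.mod_eq_of_lt hj]

theorem zigzagNext_self : zigzagNext r r = none := by simp [zigzagNext]

theorem zigzagNext_natCast {j : ℕ} (h0 : 0 < j) (hj : j < r) :
    zigzagNext r j = some (-(j : ZMod (2 * r))) := by
  have h1 : (j : ZMod (2 * r)) ≠ r := by
    rw [Ne, natCast_inj_of_lt] <;> omega
  have h2 : (j : ZMod (2 * r)).val = j := ZMod.val_natCast_of_lt (by omega)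
  simp [zigzagNext, h1, h2, h0, hj]

theorem neg_natCast_eq {j : ℕ} (hj : j ≤ 2 * r) :
    -(j : ZMod (2 * r)) = ((2 * r - j : ℕ) : ZMod (2 * r)) := by
  rw [Nat.cast_sub hj, ZMod.natCast_self, zero_sub]

theorem zigzagNext_neg_natCast {j : ℕ} (hj : j < r) :
    zigzagNext r (-(j : ZMod (2 * r))) = some (1 + (j : ZMod (2 * r))) := by
  rcases Nat.eq_zero_or_pos j with rfl | h0
  · have h1 : (0 : ZMod (2 * r)) ≠ r := by
      rw [← Nat.cast_zero, Ne, natCast_inj_of_lt] <;> omega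
    simp [zigzagNext, h1]
  · have h2 : (-(j : ZMod (2 * r))).val = 2 * r - j := by
      rw [neg_natCast_eq (by omega)]; exact ZMod.val_natCast_of_lt (by omega)
    have h1 : -(j : ZMod (2 * r)) ≠ r := by
      rw [neg_natCast_eq (by omega), Ne, natCast_inj_of_lt] <;> omega
    have h3 : ¬ (2 * r - j < r) := by omega
    simp [zigzagNext, h1, h2, h3]

theorem exists_natCast_or_neg (hr : 0 < r) (x : ZMod (2 * r)) :
    x = r ∨ (∃ j : ℕ, 0 < j ∧ j < r ∧ x = j) ∨ ∃ j : ℕ, j < r ∧ x = -(j : ZMod (2 * r)) := by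
  have : NeZero (2 * r) := ⟨by omega⟩
  have hlt := x.val_lt
  have hx : ((x.val : ℕ) : ZMod (2 * r)) = x := ZMod.natCast_zmod_val x
  rcases Nat.eq_zero_or_pos x.val with h | h
  · exact .inr (.inr ⟨0, hr, by rw [← hx, h]; simp⟩)
  rcases lt_trichotomy x.val r with h' | h' | h'
  · exact .inr (.inl ⟨x.val, h, h', hx.symm⟩)
  · exact .inl (by rw [← hx, h'])
  · refine .inr (.inr ⟨2 * r - x.val, by omega, ?_⟩)
    rw [neg_natCast_eq (by omega), ← hx, ZMod.val_natCast, Nat.mod_eq_of_lt hlt]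
    congr 1
    omega

theorem isHamiltonianMap_zigzag (hr : 0 < r) (s : ZMod (2 * r)) :
    IsHamiltonianMap (zigzag r s) := by
  have hpos : ∀ j : ℕ, 0 < j → j < r →
      zigzag r s (some (s + j)) = some (s - (j : ZMod (2 * r))) := by
    intro j h0 hj
    simp [zigzag, zigzagNext_natCast h0 hj]
    ring
  have hneg : ∀ j : ℕ, j < r →
      zigzag r s (some (s - j)) = some (s + ((j + 1 : ℕ) : ZMod (2 * r))) := by
    intro j hj
    have : s - (j : ZMod (2 * r)) - s = -(j : ZMod (2 * r)) := by ring
    simp [zigzag, this, zigzagNext_neg_natCast hj]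
    ring
  have hend : zigzag r s (some (s + r)) = none := by simp [zigzag, zigzagNext_self]
  have fwd : ∀ j : ℕ, j < r →
      Relation.ReflTransGen (fun a b => zigzag r s a = b) none (some (s - j)) := by
    intro j
    induction j with
    | zero => intro _; exact .single (by simp [zigzag])
    | succ j ih =>
      intro hj
      exact ((ih (by omega)).tail (hneg j (by omega))).tail (hpos (j + 1) (by omega) hj)
  have bwd : ∀ d j : ℕ, 0 < j → j + d = r →
      Relation.ReflTransGen (fun a b => zigzag r s a = b) (some (s + j)) none := by
    intro d
    induction d with
    | zero => rintro j - rfl; exact .single hend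
    | succ d ih =>
      intro j h0 hj
      exact .head (hpos j h0 (by omega)) (.head (hneg j (by omega)) (ih (j + 1) (by omega)
        (by omega)))
  refine .of_base none ?_ ?_
  · rintro (_ | x)
    · exact .refl
    obtain ⟨y, rfl⟩ : ∃ y, x = s + y := ⟨x - s, by ring⟩
    rcases exists_natCast_or_neg hr y with rfl | ⟨j, h0, hj, rfl⟩ | ⟨j, hj, rfl⟩
    · have := (fwd (r - 1) (by omega)).tail (hneg (r - 1) (by omega))
      rwa [Nat.sub_add_cancel hr] at this
    · have := (fwd (j - 1) (by omega)).tail (hneg (j - 1) (by omega))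
      rwa [Nat.sub_add_cancel h0] at this
    · simpa [sub_eq_add_neg] using fwd j hj
  · rintro (_ | x)
    · exact .refl
    obtain ⟨y, rfl⟩ : ∃ y, x = s + y := ⟨x - s, by ring⟩
    rcases exists_natCast_or_neg hr y with rfl | ⟨j, h0, hj, rfl⟩ | ⟨j, hj, rfl⟩
    · exact .single hend
    · exact bwd (r - j) j h0 (by omega)
    · rw [← sub_eq_add_neg]
      exact .head (hneg j hj) (bwd (r - (j + 1)) (j + 1) (by omega) (by omega))

theorem natCast_odd_ne_zero (i : ℕ) : ((2 * i + 1 : ℕ) : ZMod (2 * r)) ≠ 0 := by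
  rw [Ne, ZMod.natCast_eq_zero_iff]
  rintro ⟨c, hc⟩
  rw [mul_assoc] at hc
  omega

theorem two_mul_natCast_inj {i j : ℕ} (hi : i < r) (hj : j < r)
    (h : (2 : ZMod (2 * r)) * i = 2 * j) : i = j := by
  have : ((2 * i : ℕ) : ZMod (2 * r)) = (2 * j : ℕ) := by push_cast; exact h
  rw [natCast_inj_of_lt] at this <;> omega

/-- The path steps `j → -j` have differences `-2j` with `0 < j < r`, and the steps `-j → j + 1` have
differences `2j + 1` with `j < r`. These are nonzero and pairwise distinct modulo `2r`, so an arc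
between finite vertices determines the translate; an arc at `∞` does so as well. -/
theorem isHamiltonianPacking_zigzag (hr : 0 < r) : IsHamiltonianPacking (zigzag r) where
  hamiltonian := isHamiltonianMap_zigzag hr
  ne_self := by
    rintro s (_ | a) h
    · simp [zigzag] at h
    obtain ⟨x, rfl⟩ : ∃ x, a = s + x := ⟨a - s, by ring⟩
    simp only [zigzag, Option.elim_some, add_sub_cancel_left] at h
    rcases exists_natCast_or_neg hr x with rfl | ⟨j, h0, hj, rfl⟩ | ⟨j, hj, rfl⟩
    · simp [zigzagNext_self] at h
    · simp only [zigzagNext_natCast h0 hj, Option.map_some, Option.some_inj] at h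
      have := two_mul_natCast_inj (i := j) (j := 0) hj hr (by push_cast; linear_combination -h)
      omega
    · simp only [zigzagNext_neg_natCast hj, Option.map_some, Option.some_inj] at h
      exact natCast_odd_ne_zero (r := r) j (by push_cast; linear_combination h)
  injective := by
    rintro (_ | a) s t h
    · simpa [zigzag] using h
    obtain ⟨x, rfl⟩ : ∃ x, s = a - x := ⟨a - s, by ring⟩
    obtain ⟨y, rfl⟩ : ∃ y, t = a - y := ⟨a - t, by ring⟩
    simp only [zigzag, Option.elim_some, sub_sub_cancel] at h
    congr 1
    -- Two even or two odd differences are compared by `two_mul_natCast_inj`, mixed ones are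
    -- separated by parity, and only the last vertex `r` of the path has image `none`.
    rcases exists_natCast_or_neg hr x with rfl | ⟨i, hi0, hi, rfl⟩ | ⟨i, hi, rfl⟩ <;>
    rcases exists_natCast_or_neg hr y with rfl | ⟨j, hj0, hj, rfl⟩ | ⟨j, hj, rfl⟩ <;>
    simp only [zigzagNext_self, zigzagNext_natCast, zigzagNext_neg_natCast, *, Option.map_some,
      Option.map_none, Option.some_inj, reduceCtorEq] at h
    · rfl
    · rw [two_mul_natCast_inj hi hj (by linear_combination -h)]
    · exact absurd (by push_cast; linear_combination -h) (natCast_odd_ne_zero (r := r) (i + j))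
    · exact absurd (by push_cast; linear_combination h) (natCast_odd_ne_zero (r := r) (i + j))
    · rw [two_mul_natCast_inj hi hj (by linear_combination h)]

end Zigzag

/-! ### Even order at least eight: a cycle transversal to the zigzag cycles -/

section EvenOrder

variable {r : ℕ}

theorem zigzag_none (s : ZMod (2 * r)) : zigzag r s none = some s := rfl

/-- This is the generic arc of both transversals: it lets them run through a parity class in steps
of `-2`. The arcs in the neighbouring lemmas serve to switch between runs. -/
theorem zigzag_add_one (hr : 2 ≤ r) (s : ZMod (2 * r)) :
    zigzag r s (some (s + 1)) = some (s - 1) := by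
  have := zigzagNext_natCast (r := r) (j := 1) (by omega) (by omega)
  rw [Nat.cast_one] at this
  simp [zigzag, this]
  ring

theorem zigzag_add_two (hr : 3 ≤ r) (s : ZMod (2 * r)) :
    zigzag r s (some (s + 2)) = some (s - 2) := by
  have := zigzagNext_natCast (r := r) (j := 2) (by omega) (by omega)
  rw [Nat.cast_two] at this
  simp [zigzag, this]
  ring

theorem zigzag_add_self (s : ZMod (2 * r)) : zigzag r s (some (s + r)) = none := by
  simp [zigzag, zigzagNext_self]

theorem two_mul_natCast_self : (2 : ZMod (2 * r)) * r = 0 := by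
  have := ZMod.natCast_self (2 * r)
  rwa [Nat.cast_mul, Nat.cast_two] at this

theorem zigzag_add_self_add_one (hr : 0 < r) (s : ZMod (2 * r)) :
    zigzag r s (some (s + r + 1)) = some (s + r) := by
  have h2 := two_mul_natCast_self (r := r)
  have := zigzagNext_neg_natCast (r := r) (j := r - 1) (by omega)
  rw [Nat.cast_sub hr, Nat.cast_one] at this
  -- Since `2r = 0`, the vertex `s + r + 1` is `s - (r - 1)`, the last but one of the path.
  have h3 : s + r + 1 - s = -((r : ZMod (2 * r)) - 1) := by linear_combination h2
  simp only [zigzag, Option.elim_some, h3, this, Option.map_some]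
  congr 1
  ring

/-- A run of steps of length two. -/
theorem reflTransGen_of_step_two {V : Type*} {h : V → V} {p : ℕ → V} {lo L : ℕ}
    (H : ∀ i < L, h (p (lo + 2 * i + 2)) = p (lo + 2 * i)) {i j : ℕ} (hij : i ≤ j) (hj : j ≤ L) :
    Relation.ReflTransGen (fun a b => h a = b) (p (lo + 2 * j)) (p (lo + 2 * i)) := by
  induction j, hij using Nat.le_induction with
  | base => exact .refl
  | succ j hij ih => exact .head (H j (by omega)) (ih (by omega))

/-- The Hamiltonian cycle used for `2 * r + 2` vertices when `r` is even. -/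
def transversalEven (r : ℕ) (x : Option (Option (ZMod (2 * r)))) :
    Option (Option (ZMod (2 * r))) :=
  x.elim (some (some (r - 2))) fun y => y.elim none fun a =>
    if a.val = 2 then some (some (-2)) else if a.val = r then some (some (r - 1))
    else if a.val = 1 then some (some 0) else if a.val = 0 then some (some (-1))
    else if a.val = r + 1 then some none else some (some (a - 2))

/-- The tail of the arc that `transversalEven r` shares with the cycle `zigzag r s`. -/
def transversalEvenTail (r : ℕ) (s : ZMod (2 * r)) : ZMod (2 * r) :=
  if s.val = 0 then 2 else if s.val = 2 * r - 1 then r else if s.val = r then 1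
  else if s.val = r - 1 then 0 else if s.val = 1 then r + 1 else s + 1

/-- The Hamiltonian cycle used for `2 * r + 2` vertices when `r` is odd. -/
def transversalOdd (r : ℕ) (x : Option (Option (ZMod (2 * r)))) :
    Option (Option (ZMod (2 * r))) :=
  x.elim (some (some (-2))) fun y => y.elim (some (some (r - 2))) fun a =>
    if a.val = r + 1 then some (some (r - 3)) else if a.val = 0 then some none
    else if a.val = r then some (some (r - 1)) else if a.val = r - 1 then none
    else some (some (a - 2))

/-- The tail of the arc that `transversalOdd r` shares with the cycle `zigzag r s`. -/
def transversalOddTail (r : ℕ) (s : ZMod (2 * r)) : Option (ZMod (2 * r)) :=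
  if s.val = r - 1 then some (r + 1) else if s.val = r then some 0
  else if s.val = r - 2 then none else if s.val = 2 * r - 1 then some r else some (s + 1)

theorem exists_natCast_lt (hr : 0 < r) (a : ZMod (2 * r)) :
    ∃ k : ℕ, k < 2 * r ∧ a = k ∧ (k : ZMod (2 * r)).val = k := by
  have : NeZero (2 * r) := ⟨by omega⟩
  exact ⟨a.val, a.val_lt, (ZMod.natCast_zmod_val a).symm, ZMod.val_natCast_of_lt a.val_lt⟩

theorem neg_two_eq (hr : 0 < r) : ((2 * r - 2 : ℕ) : ZMod (2 * r)) = -2 := by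
  rw [← neg_natCast_eq (by omega), Nat.cast_two]

theorem neg_one_eq (hr : 0 < r) : ((2 * r - 1 : ℕ) : ZMod (2 * r)) = -1 := by
  rw [← neg_natCast_eq (by omega), Nat.cast_one]

/-- With `*` the new vertex, the cycle is `*, r-2, …, 2, -2, …, r, r-1, …, 1, 0, -1, …, r+1, ∞, *`,
where dots stand for steps of `-2`. -/
theorem isHamiltonianMap_transversalEven (hr : 4 ≤ r) (he : Even r) :
    IsHamiltonianMap (transversalEven r) := by
  obtain ⟨q, hq⟩ := he
  set h := transversalEven r with hdef
  set p : ℕ → Option (Option (ZMod (2 * r))) := fun k => some (some (k : ZMod (2 * r))) with hp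
  have hval : ∀ k, k < 2 * r → (k : ZMod (2 * r)).val = k := fun k => ZMod.val_natCast_of_lt
  have step : ∀ k, k + 2 < 2 * r → k ≠ 0 → k + 2 ≠ r → k + 2 ≠ r + 1 → h (p (k + 2)) = p k := by
    intro k hk h0 h1 h2
    simp only [hdef, hp, transversalEven, Option.elim_some, hval _ hk]
    rw [if_neg (by omega), if_neg (by omega), if_neg (by omega), if_neg (by omega),
      if_neg (by omega)]
    simp
  have e2 : h (p 2) = p (2 * r - 2) := by
    simp [hdef, hp, transversalEven, hval 2 (by omega), neg_two_eq (r := r) (by omega),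
      -Nat.cast_ofNat]
  have er : h (p r) = p (r - 1) := by
    simp only [hdef, hp, transversalEven, Option.elim_some, hval r (by omega)]
    rw [if_neg (by omega), if_pos trivial, Nat.cast_sub (by omega), Nat.cast_one]
  have e1 : h (p 1) = p 0 := by
    simp only [hdef, hp, transversalEven, Option.elim_some, hval 1 (by omega)]
    rw [if_neg (by omega), if_neg (by omega), if_pos trivial, Nat.cast_zero]
  have e0 : h (p 0) = p (2 * r - 1) := by
    simp only [hdef, hp, transversalEven, Option.elim_some, hval 0 (by omega)]
    rw [if_neg (by omega), if_neg (by omega), if_neg (by omega), if_pos trivial,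
      neg_one_eq (by omega)]
  have er1 : h (p (r + 1)) = some none := by
    simp only [hdef, hp, transversalEven, Option.elim_some, hval (r + 1) (by omega)]
    rw [if_neg (by omega), if_neg (by omega), if_neg (by omega), if_neg (by omega), if_pos trivial]
  have en : h none = p (r - 2) := by
    simp [hdef, hp, transversalEven, Nat.cast_sub (show 2 ≤ r by omega)]
  have ei : h (some none) = none := rfl
  -- The four runs, in the order of the cycle: evens in `[2, r-2]`, evens from `r`, odds below `r`,
  -- odds from `r + 1`. Each is entered at its largest index.
  have sA : ∀ i j, i ≤ j → j ≤ q - 2 → _ := fun i j => reflTransGen_of_step_two (h := h) (p := p)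
    (lo := 2) (fun i hi => step _ (by omega) (by omega) (by omega) (by omega))
  have sB : ∀ i j, i ≤ j → j ≤ q - 1 → _ := fun i j => reflTransGen_of_step_two (h := h) (p := p)
    (lo := r) (fun i hi => step _ (by omega) (by omega) (by omega) (by omega))
  have sC : ∀ i j, i ≤ j → j ≤ q - 1 → _ := fun i j => reflTransGen_of_step_two (h := h) (p := p)
    (lo := 1) (fun i hi => step _ (by omega) (by omega) (by omega) (by omega))
  have sD : ∀ i j, i ≤ j → j ≤ q - 1 → _ := fun i j => reflTransGen_of_step_two (h := h) (p := p)
    (lo := r + 1) (fun i hi => step _ (by omega) (by omega) (by omega) (by omega))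
  have cover : ∀ P : Option (Option (ZMod (2 * r))) → Prop, P none → P (some none) → P (p 0) →
      (∀ i ≤ q - 2, P (p (2 + 2 * i))) → (∀ i ≤ q - 1, P (p (r + 2 * i))) →
      (∀ i ≤ q - 1, P (p (1 + 2 * i))) → (∀ i ≤ q - 1, P (p (r + 1 + 2 * i))) → ∀ v, P v := by
    rintro P h1 h2 h3 hA hB hC hD (_ | _ | a)
    · exact h1
    · exact h2
    obtain ⟨k, hk, rfl, -⟩ := exists_natCast_lt (by omega) a
    change P (p k)
    obtain ⟨j, hj⟩ | ⟨j, hj⟩ := Nat.even_or_odd k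
    · rcases Nat.eq_zero_or_pos k with rfl | hk0
      · exact h3
      by_cases hkr : k < r
      · rw [show k = 2 + 2 * (j - 1) by omega]; exact hA _ (by omega)
      · rw [show k = r + 2 * (j - q) by omega]; exact hB _ (by omega)
    · by_cases hkr : k < r
      · rw [show k = 1 + 2 * j by omega]; exact hC _ (by omega)
      · rw [show k = r + 1 + 2 * (j - q) by omega]; exact hD _ (by omega)
  have tA : p (2 + 2 * (q - 2)) = h none := by rw [en]; congr 1; omega
  have tB : p (r + 2 * (q - 1)) = h (p 2) := by rw [e2]; congr 1; omega
  have tC : p (1 + 2 * (q - 1)) = h (p r) := by rw [er]; congr 1; omega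
  have tD : p (r + 1 + 2 * (q - 1)) = h (p 0) := by rw [e0]; congr 1; omega
  -- The names in `f` are walks from the new vertex, those in `g` walks back to it.
  have fA : ∀ i ≤ q - 2, _ := fun i hi =>
    Relation.ReflTransGen.head (r := fun a b => h a = b) tA.symm (sA i _ hi le_rfl)
  have fB : ∀ i ≤ q - 1, _ := fun i hi =>
    (fA 0 (by omega)).trans (.head tB.symm (sB i _ hi le_rfl))
  have fC : ∀ i ≤ q - 1, _ := fun i hi =>
    (fB 0 (by omega)).trans (.head tC.symm (sC i _ hi le_rfl))
  have f0 := (fC 0 (by omega)).tail e1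
  have fD : ∀ i ≤ q - 1, _ := fun i hi => f0.trans (.head tD.symm (sD i _ hi le_rfl))
  have fi := (fD 0 (by omega)).tail er1
  have gD : ∀ i ≤ q - 1, _ := fun i hi => (sD 0 i (by omega) hi).tail er1 |>.tail ei
  have g0 := Relation.ReflTransGen.head (r := fun a b => h a = b) tD.symm (gD _ le_rfl)
  have gC : ∀ i ≤ q - 1, _ := fun i hi => ((sC 0 i (by omega) hi).tail e1).trans g0
  have gB : ∀ i ≤ q - 1, _ := fun i hi =>
    ((sB 0 i (by omega) hi).tail tC.symm).trans (gC _ le_rfl)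
  have gA : ∀ i ≤ q - 2, _ := fun i hi =>
    ((sA 0 i (by omega) hi).tail tB.symm).trans (gB _ le_rfl)
  exact .of_base none (cover _ .refl fi f0 fA fB fC fD) (cover _ .refl (.single ei) g0 gA gB gC gD)

/-- The cycle is `*, -2, …, r+1, r-3, …, 0, ∞, r-2, …, 1, -1, …, r, r-1, *`, with dots for steps of
`-2`. -/
theorem isHamiltonianMap_transversalOdd (hr : 3 ≤ r) (ho : Odd r) :
    IsHamiltonianMap (transversalOdd r) := by
  obtain ⟨q, hq⟩ := ho
  set h := transversalOdd r with hdef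
  set p : ℕ → Option (Option (ZMod (2 * r))) := fun k => some (some (k : ZMod (2 * r))) with hp
  have hval : ∀ k, k < 2 * r → (k : ZMod (2 * r)).val = k := fun k => ZMod.val_natCast_of_lt
  have step : ∀ k, k + 2 < 2 * r → k + 2 ≠ r → k + 2 ≠ r + 1 → k + 2 ≠ r - 1 →
      h (p (k + 2)) = p k := by
    intro k hk h0 h1 h2
    simp only [hdef, hp, transversalOdd, Option.elim_some, hval _ hk]
    rw [if_neg (by omega), if_neg (by omega), if_neg (by omega), if_neg (by omega)]
    simp
  have er1 : h (p (r + 1)) = p (r - 3) := by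
    simp only [hdef, hp, transversalOdd, Option.elim_some, hval (r + 1) (by omega)]
    rw [if_pos trivial, Nat.cast_sub (by omega), Nat.cast_ofNat]
  have e0 : h (p 0) = some none := by
    simp only [hdef, hp, transversalOdd, Option.elim_some, hval 0 (by omega)]
    rw [if_neg (by omega), if_pos trivial]
  have er : h (p r) = p (r - 1) := by
    simp only [hdef, hp, transversalOdd, Option.elim_some, hval r (by omega)]
    rw [if_neg (by omega), if_neg (by omega), if_pos trivial, Nat.cast_sub (by omega), Nat.cast_one]
  have ez : h (p (r - 1)) = none := by
    simp only [hdef, hp, transversalOdd, Option.elim_some, hval (r - 1) (by omega)]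
    rw [if_neg (by omega), if_neg (by omega), if_neg (by omega), if_pos trivial]
  -- The vertex `1` follows the generic rule, but `1 - 2` wraps around to `2r - 1`, which `step`
  -- does not cover.
  have e1 : h (p 1) = p (2 * r - 1) := by
    simp only [hdef, hp, transversalOdd, Option.elim_some, hval 1 (by omega)]
    rw [if_neg (by omega), if_neg (by omega), if_neg (by omega), if_neg (by omega),
      neg_one_eq (by omega)]
    norm_num
  have en : h none = p (2 * r - 2) := by
    simp [hdef, hp, transversalOdd, neg_two_eq (r := r) (by omega)]
  have ei : h (some none) = p (r - 2) := by
    simp [hdef, hp, transversalOdd, Nat.cast_sub (show 2 ≤ r by omega)]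
  have sA : ∀ i j, i ≤ j → j ≤ q - 1 → _ := fun i j => reflTransGen_of_step_two (h := h) (p := p)
    (lo := r + 1) (fun i hi => step _ (by omega) (by omega) (by omega) (by omega))
  have sB : ∀ i j, i ≤ j → j ≤ q - 1 → _ := fun i j => reflTransGen_of_step_two (h := h) (p := p)
    (lo := 0) (fun i hi => step _ (by omega) (by omega) (by omega) (by omega))
  have sC : ∀ i j, i ≤ j → j ≤ q - 1 → _ := fun i j => reflTransGen_of_step_two (h := h) (p := p)
    (lo := 1) (fun i hi => step _ (by omega) (by omega) (by omega) (by omega))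
  have sD : ∀ i j, i ≤ j → j ≤ q → _ := fun i j => reflTransGen_of_step_two (h := h) (p := p)
    (lo := r) (fun i hi => step _ (by omega) (by omega) (by omega) (by omega))
  have cover : ∀ P : Option (Option (ZMod (2 * r))) → Prop, P none → P (some none) →
      P (p (r - 1)) →
      (∀ i ≤ q - 1, P (p (r + 1 + 2 * i))) → (∀ i ≤ q - 1, P (p (0 + 2 * i))) →
      (∀ i ≤ q - 1, P (p (1 + 2 * i))) → (∀ i ≤ q, P (p (r + 2 * i))) → ∀ v, P v := by
    rintro P h1 h2 h3 hA hB hC hD (_ | _ | a)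
    · exact h1
    · exact h2
    obtain ⟨k, hk, rfl, -⟩ := exists_natCast_lt (by omega) a
    change P (p k)
    -- The vertex `r - 1` lies on no run; it is the last one before the new vertex.
    by_cases hkr1 : k = r - 1
    · rw [hkr1]; exact h3
    obtain ⟨j, hj⟩ | ⟨j, hj⟩ := Nat.even_or_odd k
    · by_cases hkr : k < r
      · rw [show k = 0 + 2 * j by omega]; exact hB _ (by omega)
      · rw [show k = r + 1 + 2 * (j - q - 1) by omega]; exact hA _ (by omega)
    · by_cases hkr : k < r
      · rw [show k = 1 + 2 * j by omega]; exact hC _ (by omega)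
      · rw [show k = r + 2 * (j - q) by omega]; exact hD _ (by omega)
  have tA : p (r + 1 + 2 * (q - 1)) = h none := by rw [en]; congr 1; omega
  have tB : p (0 + 2 * (q - 1)) = h (p (r + 1)) := by rw [er1]; congr 1; omega
  have tC : p (1 + 2 * (q - 1)) = h (some none) := by rw [ei]; congr 1; omega
  have tD : p (r + 2 * q) = h (p 1) := by rw [e1]; congr 1; omega
  have fA : ∀ i ≤ q - 1, _ := fun i hi =>
    Relation.ReflTransGen.head (r := fun a b => h a = b) tA.symm (sA i _ hi le_rfl)
  have fB : ∀ i ≤ q - 1, _ := fun i hi =>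
    (fA 0 (by omega)).trans (.head tB.symm (sB i _ hi le_rfl))
  have fi := (fB 0 (by omega)).tail e0
  have fC : ∀ i ≤ q - 1, _ := fun i hi => fi.trans (.head tC.symm (sC i _ hi le_rfl))
  have fD : ∀ i ≤ q, _ := fun i hi =>
    (fC 0 (by omega)).trans (.head tD.symm (sD i _ hi le_rfl))
  have fz := (fD 0 (by omega)).tail er
  have gz := Relation.ReflTransGen.single (r := fun a b => h a = b) ez
  have gD : ∀ i ≤ q, _ := fun i hi => ((sD 0 i (by omega) hi).tail er).trans gz
  have gC : ∀ i ≤ q - 1, _ := fun i hi =>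
    ((sC 0 i (by omega) hi).tail tD.symm).trans (gD _ le_rfl)
  have gi := Relation.ReflTransGen.head (r := fun a b => h a = b) tC.symm (gC _ le_rfl)
  have gB : ∀ i ≤ q - 1, _ := fun i hi => ((sB 0 i (by omega) hi).tail e0).trans gi
  have gA : ∀ i ≤ q - 1, _ := fun i hi =>
    ((sA 0 i (by omega) hi).tail tB.symm).trans (gB _ le_rfl)
  exact .of_base none (cover _ .refl fi fz fA fB fC fD) (cover _ .refl gi gz gA gB gC gD)

theorem IsHamiltonianMap.ne_self {V : Type*} [Nontrivial V] {f : V → V} (hf : IsHamiltonianMap f)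
    (v : V) : f v ≠ v := by
  intro h
  obtain ⟨u, hu⟩ := exists_ne v
  have key : ∀ w, Relation.ReflTransGen (fun a b => f a = b) v w → w = v := by
    intro w hw
    induction hw with
    | refl => rfl
    | tail _ hbc ih => rw [← hbc, ih, h]
  exact hu (key u (hf v u))

/-- The shifts `0, -1, r, r-1, 1` supply the switching arcs `2 → -2`, `r → r-1`, `1 → 0`, `0 → -1`,
`r+1 → ∞`; every other shift `s` supplies `s+1 → s-1`. -/
theorem transversalEvenTail_spec (hr : 4 ≤ r) (s : ZMod (2 * r)) :
    transversalEven r (some (some (transversalEvenTail r s))) =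
      some (zigzag r s (some (transversalEvenTail r s))) := by
  have h2 := two_mul_natCast_self (r := r)
  obtain ⟨k, hk, rfl, hv⟩ := exists_natCast_lt (by omega) s
  have hval : ∀ k, k < 2 * r → (k : ZMod (2 * r)).val = k := fun k => ZMod.val_natCast_of_lt
  unfold transversalEvenTail
  rw [hv]
  split_ifs with c1 c2 c3 c4 c5
  · subst c1
    have := zigzag_add_two (r := r) (by omega) 0
    have v2 := hval 2 (by omega)
    simp only [zero_add, zero_sub, Nat.cast_ofNat] at this v2
    simp [transversalEven, v2, this]
  · have hk1 : (k : ZMod (2 * r)) = -1 := by rw [c2, neg_one_eq (by omega)]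
    have := zigzag_add_self_add_one (r := r) (by omega) (-1)
    rw [show (-1 : ZMod (2 * r)) + r + 1 = r by ring] at this
    rw [hk1, this]
    simp only [transversalEven, Option.elim_some, hval r (by omega)]
    rw [if_neg (by omega), if_pos trivial]
    congr 2; ring
  · subst c3
    have := zigzag_add_self_add_one (r := k) (by omega) k
    rw [show (k : ZMod (2 * k)) + k + 1 = 1 by linear_combination h2,
      show (k : ZMod (2 * k)) + k = 0 by linear_combination h2] at this
    have v2 := hval 1 (by omega)
    rw [Nat.cast_one] at v2
    rw [this]
    simp only [transversalEven, Option.elim_some, v2]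
    rw [if_neg (by omega), if_neg (by omega), if_pos trivial]
  · have hk1 : (k : ZMod (2 * r)) = r - 1 := by
      rw [c4, Nat.cast_sub (by omega), Nat.cast_one]
    have := zigzag_add_self_add_one (r := r) (by omega) (r - 1)
    rw [show (r - 1 : ZMod (2 * r)) + r + 1 = 0 by linear_combination h2,
      show (r - 1 : ZMod (2 * r)) + r = -1 by linear_combination h2] at this
    rw [hk1, this]
    simp only [transversalEven, Option.elim_some, ZMod.val_zero]
    rw [if_neg (by omega), if_neg (by omega), if_neg (by omega), if_pos trivial]
  · subst c5
    have := zigzag_add_self (r := r) 1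
    rw [add_comm] at this
    have v2 := hval (r + 1) (by omega)
    push_cast at v2
    rw [Nat.cast_one, this]
    simp only [transversalEven, Option.elim_some, v2]
    rw [if_neg (by omega), if_neg (by omega), if_neg (by omega), if_neg (by omega), if_pos trivial]
  · have v2 := hval (k + 1) (by omega)
    push_cast at v2
    rw [zigzag_add_one (by omega)]
    simp only [transversalEven, Option.elim_some, v2]
    rw [if_neg (by omega), if_neg (by omega), if_neg (by omega), if_neg (by omega),
      if_neg (by omega)]
    congr 2; ring

theorem exists_transversalEvenTail_eq (hr : 4 ≤ r) (a : ZMod (2 * r)) :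
    ∃ s, transversalEvenTail r s = a := by
  obtain ⟨k, hk, rfl, -⟩ := exists_natCast_lt (by omega) a
  have key : ∀ l, l < 2 * r → transversalEvenTail r l = if l = 0 then (2 : ZMod (2 * r)) else
      if l = 2 * r - 1 then (r : ZMod (2 * r)) else if l = r then 1
      else if l = r - 1 then 0 else if l = 1 then r + 1 else (l : ZMod (2 * r)) + 1 := by
    intro l hl
    rw [transversalEvenTail, ZMod.val_natCast_of_lt hl]
  by_cases c1 : k = 2
  · exact ⟨(0 : ℕ), by rw [key _ (by omega), if_pos rfl, c1]; simp⟩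
  by_cases c2 : k = r
  · exact ⟨(2 * r - 1 : ℕ), by rw [key _ (by omega), if_neg (by omega), if_pos rfl, c2]⟩
  by_cases c3 : k = 1
  · exact ⟨r, by rw [key _ (by omega), if_neg (by omega), if_neg (by omega), if_pos rfl, c3]; simp⟩
  by_cases c4 : k = 0
  · exact ⟨(r - 1 : ℕ), by
      rw [key _ (by omega), if_neg (by omega), if_neg (by omega), if_neg (by omega), if_pos rfl,
        c4]; simp⟩
  by_cases c5 : k = r + 1
  · exact ⟨(1 : ℕ), by
      rw [key _ (by omega), if_neg (by omega), if_neg (by omega), if_neg (by omega),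
        if_neg (by omega), if_pos rfl, c5]; simp⟩
  · exact ⟨(k - 1 : ℕ), by
      rw [key _ (by omega), if_neg (by omega), if_neg (by omega), if_neg (by omega),
        if_neg (by omega), if_neg (by omega), Nat.cast_sub (by omega)]; simp⟩

/-- The shifts `r-1, r, r-2, -1` supply `r+1 → r-3`, `0 → ∞`, `∞ → r-2`, `r → r-1`; every other
shift `s` supplies `s+1 → s-1`. -/
theorem transversalOddTail_spec (hr : 3 ≤ r) (s : ZMod (2 * r)) :
    transversalOdd r (some (transversalOddTail r s)) =
      some (zigzag r s (transversalOddTail r s)) := by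
  have h2 := two_mul_natCast_self (r := r)
  obtain ⟨k, hk, rfl, hv⟩ := exists_natCast_lt (by omega) s
  have hval : ∀ k, k < 2 * r → (k : ZMod (2 * r)).val = k := fun k => ZMod.val_natCast_of_lt
  unfold transversalOddTail
  rw [hv]
  split_ifs with c1 c2 c3 c4
  · have hk1 : (k : ZMod (2 * r)) = r - 1 := by
      rw [c1, Nat.cast_sub (by omega), Nat.cast_one]
    have := zigzag_add_two (r := r) hr (r - 1)
    rw [show (r - 1 : ZMod (2 * r)) + 2 = r + 1 by ring,
      show (r - 1 : ZMod (2 * r)) - 2 = r - 3 by ring] at this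
    have v2 := hval (r + 1) (by omega)
    push_cast at v2
    rw [hk1, this]
    simp only [transversalOdd, Option.elim_some, v2]
    rw [if_pos trivial]
  · subst c2
    have := zigzag_add_self (r := k) k
    rw [show (k : ZMod (2 * k)) + k = 0 by linear_combination h2] at this
    rw [this]
    simp only [transversalOdd, Option.elim_some, ZMod.val_zero]
    rw [if_neg (by omega), if_pos trivial]
  · simp [transversalOdd, zigzag_none, c3, Nat.cast_sub (show 2 ≤ r by omega)]
  · have hk1 : (k : ZMod (2 * r)) = -1 := by rw [c4, neg_one_eq (by omega)]
    have := zigzag_add_self_add_one (r := r) (by omega) (-1)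
    rw [show (-1 : ZMod (2 * r)) + r + 1 = r by ring] at this
    rw [hk1, this]
    simp only [transversalOdd, Option.elim_some, hval r (by omega)]
    rw [if_neg (by omega), if_neg (by omega), if_pos trivial]
    congr 2; ring
  · have v2 := hval (k + 1) (by omega)
    push_cast at v2
    rw [zigzag_add_one (by omega)]
    simp only [transversalOdd, Option.elim_some, v2]
    rw [if_neg (by omega), if_neg (by omega), if_neg (by omega), if_neg (by omega)]
    congr 2; ring

theorem exists_transversalOddTail_eq (hr : 3 ≤ r) (x : Option (ZMod (2 * r)))
    (hx : transversalOdd r (some x) ≠ none) : ∃ s, transversalOddTail r s = x := by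
  have key : ∀ l, l < 2 * r → transversalOddTail r l = if l = r - 1 then some (r + 1 : ZMod (2 * r))
      else if l = r then some 0 else if l = r - 2 then none
      else if l = 2 * r - 1 then some (r : ZMod (2 * r)) else some ((l : ZMod (2 * r)) + 1) := by
    intro l hl
    rw [transversalOddTail, ZMod.val_natCast_of_lt hl]
  rcases x with _ | a
  · exact ⟨(r - 2 : ℕ), by
      rw [key _ (by omega), if_neg (by omega), if_neg (by omega), if_pos rfl]⟩
  obtain ⟨k, hk, rfl, hv⟩ := exists_natCast_lt (by omega) a
  by_cases c1 : k = r + 1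
  · exact ⟨(r - 1 : ℕ), by rw [key _ (by omega), if_pos rfl, c1]; simp⟩
  by_cases c2 : k = 0
  · exact ⟨r, by rw [key _ (by omega), if_neg (by omega), if_pos rfl, c2]; simp⟩
  by_cases c3 : k = r
  · exact ⟨(2 * r - 1 : ℕ), by
      rw [key _ (by omega), if_neg (by omega), if_neg (by omega), if_neg (by omega), if_pos rfl,
        c3]⟩
  by_cases c4 : k = r - 1
  · refine absurd ?_ hx
    simp only [transversalOdd, Option.elim_some, hv]
    rw [if_neg (by omega), if_neg (by omega), if_neg (by omega), if_pos c4]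
  · exact ⟨(k - 1 : ℕ), by
      rw [key _ (by omega), if_neg (by omega), if_neg (by omega), if_neg (by omega),
        if_neg (by omega), Nat.cast_sub (by omega)]; simp⟩

/-- The arcs of the complete digraph on `2 * r + 2` vertices decompose into Hamiltonian cycles if
`r` is at least three. -/
theorem exists_isHamiltonianPacking_even (hr : 3 ≤ r) :
    ∃ f : Option (ZMod (2 * r)) → Option (Option (ZMod (2 * r))) → Option (Option (ZMod (2 * r))),
      IsHamiltonianPacking f := by
  have : NeZero (2 * r) := ⟨by omega⟩
  have hz := isHamiltonianPacking_zigzag (r := r) (by omega)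
  obtain he | ho := Nat.even_or_odd r
  · have hr4 : 4 ≤ r := by obtain ⟨q, hq⟩ := he; omega
    have hh := isHamiltonianMap_transversalEven hr4 he
    refine ⟨_, hz.extend hh hh.ne_self (fun s => some (transversalEvenTail r s))
      (transversalEvenTail_spec hr4) ?_⟩
    rintro (_ | a) ha
    · exact absurd rfl ha
    · obtain ⟨s, hs⟩ := exists_transversalEvenTail_eq hr4 a
      exact ⟨s, congrArg some hs⟩
  · have hh := isHamiltonianMap_transversalOdd hr ho
    exact ⟨_, hz.extend hh hh.ne_self _ (transversalOddTail_spec hr)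
      (exists_transversalOddTail_eq hr)⟩

end EvenOrder

/-! ### Packings on `Fin k` -/

/-- The bound `n` on the exponents makes both hypotheses decidable for concrete maps on `Fin k`. -/
theorem IsHamiltonianMap.of_iterate {V : Type*} {f : V → V} (b : V) (n : ℕ)
    (h₁ : ∀ v, ∃ j < n, f^[j] b = v) (h₂ : ∀ v, ∃ j < n, f^[j] v = b) : IsHamiltonianMap f := by
  have key : ∀ j v, Relation.ReflTransGen (fun a b => f a = b) v (f^[j] v) := by
    intro j v
    induction j with
    | zero => exact .refl
    | succ j ih => exact ih.tail (Function.iterate_succ_apply' f j v).symm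
  refine .of_base b (fun v => ?_) fun v => ?_
  · obtain ⟨j, -, rfl⟩ := h₁ v
    exact key j b
  · obtain ⟨j, -, hj⟩ := h₂ v
    exact hj ▸ key j v

/-- The complete digraph on `k` vertices has `k - 1` pairwise arc-disjoint Hamiltonian cycles,
unless `k` is four or six. -/
theorem exists_isHamiltonianPacking_fin {k : ℕ} (hk : 2 ≤ k) (h4 : k ≠ 4) (h6 : k ≠ 6) :
    ∃ f : Fin (k - 1) → Fin k → Fin k, IsHamiltonianPacking f := by
  have transfer : ∀ {ι V : Type} [Fintype ι] [Fintype V] {f : ι → V → V},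
      IsHamiltonianPacking f → Fintype.card ι = k - 1 → Fintype.card V = k →
      ∃ f : Fin (k - 1) → Fin k → Fin k, IsHamiltonianPacking f := fun hf hι hV =>
    ⟨_, hf.congr (Fintype.equivFinOfCardEq hV) (Fintype.equivFinOfCardEq hι).symm.toEmbedding⟩
  obtain ⟨r, hr⟩ | ⟨r, hr⟩ := Nat.even_or_odd k
  · by_cases hk2 : k = 2
    · subst hk2
      exact ⟨fun _ v => 1 - v, ⟨fun _ => .of_iterate 0 2 (by decide) (by decide), by decide,
        fun _ i j _ => Subsingleton.elim (α := Fin 1) i j⟩⟩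
    · obtain ⟨q, rfl⟩ : ∃ q, r = q + 1 := ⟨r - 1, by omega⟩
      have : NeZero (2 * q) := ⟨by omega⟩
      obtain ⟨f, hf⟩ := exists_isHamiltonianPacking_even (r := q) (by omega)
      exact transfer hf (by simp [ZMod.card]; omega) (by simp [ZMod.card]; omega)
  · have : NeZero (2 * r) := ⟨by omega⟩
    exact transfer (isHamiltonianPacking_zigzag (r := r) (by omega)) (by simp [ZMod.card]; omega)
      (by simp [ZMod.card]; omega)

theorem exists_isHamiltonianPacking_fin_four :
    ∃ f : Fin 2 → Fin 4 → Fin 4, IsHamiltonianPacking f := by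
  refine ⟨![![1, 2, 3, 0], ![3, 0, 1, 2]], ⟨fun i => .of_iterate 0 4 ?_ ?_, by decide, ?_⟩⟩
  · revert i; decide
  · revert i; decide
  · intro v i j h
    revert v i j
    decide

/-- Two edge-disjoint undirected Hamiltonian cycles of `K₆`, each traversed in both directions. -/
theorem exists_isHamiltonianPacking_fin_six :
    ∃ f : Fin 4 → Fin 6 → Fin 6, IsHamiltonianPacking f := by
  refine ⟨![![1, 2, 3, 4, 5, 0], ![5, 0, 1, 2, 3, 4], ![2, 5, 4, 0, 1, 3], ![3, 4, 0, 5, 2, 1]],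
    ⟨fun i => .of_iterate 0 6 ?_ ?_, by decide, ?_⟩⟩
  · revert i; decide
  · revert i; decide
  · intro v i j h
    revert v i j
    decide

/-! ### No decomposition on four or six vertices -/

/-- The arcs of the Hamiltonian cycles of the complete digraph on `{0, …, m}` that contain the arc
`(0, h)`. -/
def hamiltonianCyclesThrough (m h : ℕ) : List (List (ℕ × ℕ)) :=
  (((List.range' 1 m).permutations').filter (·.head? = some h)).map
    fun l => (0 :: l).zip (l ++ [0])

theorem IsHamiltonianMap.minimalPeriod_eq {V : Type*} [Fintype V] [Nontrivial V] {f : V → V}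
    (hf : IsHamiltonianMap f) (v : V) : Function.minimalPeriod f v = Fintype.card V := by
  have hreach : ∀ w, ∃ j, f^[j] v = w := by
    intro w
    induction hf v w with
    | refl => exact ⟨0, rfl⟩
    | tail _ hbc ih =>
      obtain ⟨j, rfl⟩ := ih
      exact ⟨j + 1, by rw [Function.iterate_succ_apply', hbc]⟩
  have hpos : 0 < Function.minimalPeriod f v :=
    Function.minimalPeriod_pos_of_mem_periodicPts (hf.injective.mem_periodicPts v)
  have hbij : Function.Bijective fun j : Fin (Function.minimalPeriod f v) => f^[j] v := by
    refine ⟨fun i j h => Fin.ext (Function.iterate_injOn_Iio_minimalPeriod i.2 j.2 h), fun w => ?_⟩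
    obtain ⟨j, rfl⟩ := hreach w
    exact ⟨⟨j % _, Nat.mod_lt _ hpos⟩, Function.iterate_mod_minimalPeriod_eq⟩
  simpa using Fintype.card_of_bijective hbij

theorem IsHamiltonianMap.exists_mem_hamiltonianCyclesThrough {m : ℕ} (hm : 0 < m)
    {f : Fin (m + 1) → Fin (m + 1)} (hf : IsHamiltonianMap f) :
    ∃ a ∈ hamiltonianCyclesThrough m (f 0), ∀ x ∈ a, ∃ v : Fin (m + 1), x = (v.val, (f v).val) := by
  have : Nontrivial (Fin (m + 1)) := Fin.nontrivial_iff_two_le.2 (by omega)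
  have hper : Function.minimalPeriod f 0 = m + 1 := by simpa using hf.minimalPeriod_eq 0
  have hinj : ∀ i j, i < m + 1 → j < m + 1 → f^[i] 0 = f^[j] 0 → i = j := fun i j hi hj h =>
    Function.iterate_injOn_Iio_minimalPeriod (f := f) (x := 0) (by simpa [hper] using hi)
      (by simpa [hper] using hj) h
  have hend : f^[m + 1] 0 = 0 := by
    have := Function.iterate_minimalPeriod (f := f) (x := 0)
    rwa [hper] at this
  -- The orbit of `0` without `0` itself; zipping `0 :: l` with `l ++ [0]` lists the arcs of the
  -- cycle.
  set l : List ℕ := (List.range m).map fun j => (f^[j + 1] 0).val with hl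
  have hl1 : 0 :: l = (List.range (m + 1)).map fun j => (f^[j] 0).val := by
    rw [List.range_succ_eq_map]
    simp [hl, Function.comp_def]
  have hl2 : l ++ [0] = (List.range (m + 1)).map fun j => (f^[j + 1] 0).val := by
    rw [List.range_succ]
    simp only [List.map_append, List.map_cons, List.map_nil, hend]
    rfl
  have hperm : l.Perm (List.range' 1 m) := by
    refine (List.subperm_of_subset ?_ ?_).perm_of_length_le (by simp [hl])
    · refine List.Nodup.map_on ?_ List.nodup_range
      intro i hi j hj h
      have := hinj (i + 1) (j + 1) (by simpa using hi) (by simpa using hj) (Fin.ext h)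
      omega
    · intro x hx
      obtain ⟨j, hj, rfl⟩ := List.mem_map.1 hx
      rw [List.mem_range] at hj
      have h0 : (f^[j + 1] 0).val ≠ 0 := fun h => by
        have := hinj (j + 1) 0 (by omega) (by omega) (Fin.ext h)
        omega
      have := (f^[j + 1] 0).isLt
      simp only [List.mem_range'_1]
      omega
  refine ⟨(0 :: l).zip (l ++ [0]), ?_, ?_⟩
  · refine List.mem_map.2 ⟨l, List.mem_filter.2 ⟨List.mem_permutations'.2 hperm, ?_⟩, rfl⟩
    obtain ⟨d, rfl⟩ : ∃ d, m = d + 1 := ⟨m - 1, by omega⟩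
    simp [hl, List.range_succ_eq_map]
  · intro x hx
    rw [hl1, hl2, List.zip_map', List.mem_map] at hx
    obtain ⟨j, -, rfl⟩ := hx
    exact ⟨f^[j] 0, by rw [Function.iterate_succ_apply']⟩

/-- In a packing of `m` Hamiltonian cycles on `m + 1` vertices every arc `(0, h)` lies on one of
the cycles. -/
theorem IsHamiltonianPacking.exists_cycleThrough {m : ℕ} (hm : 0 < m)
    {f : Fin m → Fin (m + 1) → Fin (m + 1)} (hf : IsHamiltonianPacking f) :
    ∃ g : ℕ → List (ℕ × ℕ), (∀ h, 1 ≤ h → h ≤ m → g h ∈ hamiltonianCyclesThrough m h) ∧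
      ∀ h h', 1 ≤ h → h ≤ m → 1 ≤ h' → h' ≤ m → h ≠ h' → ∀ x ∈ g h, x ∉ g h' := by
  -- The `m` cycles leave `0` by distinct arcs, and there are only `m` possible heads. So the cycles
  -- can be labelled by the successor of `0`, which removes their symmetry from the search.
  have hbij : Function.Bijective fun i : Fin m =>
      (⟨f i 0, hf.ne_self i 0⟩ : {v : Fin (m + 1) // v ≠ 0}) := by
    rw [Fintype.bijective_iff_injective_and_card]
    refine ⟨fun i j h => hf.injective 0 (congrArg Subtype.val h), by simp⟩
  have hex : ∀ h, ∃ a : List (ℕ × ℕ), 1 ≤ h → h ≤ m → a ∈ hamiltonianCyclesThrough m h ∧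
      ∃ i : Fin m, (f i 0).val = h ∧ ∀ x ∈ a, ∃ v : Fin (m + 1), x = (v.val, (f i v).val) := by
    intro h
    by_cases hh : 1 ≤ h ∧ h ≤ m
    · obtain ⟨i, hi⟩ := hbij.2 ⟨⟨h, by omega⟩, fun H => by simp [Fin.ext_iff] at H; omega⟩
      have hi' : (f i 0).val = h := congrArg (fun v => v.1.val) hi
      obtain ⟨a, ha, hx⟩ := (hf.hamiltonian i).exists_mem_hamiltonianCyclesThrough hm
      exact ⟨a, fun _ _ => ⟨hi' ▸ ha, i, hi', hx⟩⟩
    · exact ⟨[], fun h1 h2 => absurd ⟨h1, h2⟩ hh⟩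
  choose g hg using hex
  refine ⟨g, fun h h1 h2 => (hg h h1 h2).1, fun h h' h1 h2 h1' h2' hne x hx hx' => hne ?_⟩
  obtain ⟨-, i, hi, hgi⟩ := hg h h1 h2
  obtain ⟨-, j, hj, hgj⟩ := hg h' h1' h2'
  obtain ⟨v, rfl⟩ := hgi x hx
  obtain ⟨w, hw⟩ := hgj _ hx'
  rw [Prod.mk.injEq] at hw
  have hvw : v = w := Fin.ext hw.1
  subst hvw
  have : i = j := hf.injective v (Fin.ext hw.2)
  rw [← hi, ← hj, this]

/-- Each disjointness condition stands as early as possible among the quantifiers, so that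
evaluation prunes incompatible choices before enumerating the next cycle. The same holds for five
below, where each list has 24 cycles. -/
theorem no_disjoint_hamiltonianCyclesThrough_three :
    ∀ a ∈ hamiltonianCyclesThrough 3 1,
    ∀ b ∈ hamiltonianCyclesThrough 3 2, (∀ x ∈ a, x ∉ b) →
    ∀ c ∈ hamiltonianCyclesThrough 3 3, (∀ x ∈ a, x ∉ c) → ¬ ∀ x ∈ b, x ∉ c := by
  decide +kernel

set_option synthInstance.maxSize 1000 in
set_option synthInstance.maxHeartbeats 200000 in
theorem no_disjoint_hamiltonianCyclesThrough_five :
    ∀ a ∈ hamiltonianCyclesThrough 5 1,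
    ∀ b ∈ hamiltonianCyclesThrough 5 2, (∀ x ∈ a, x ∉ b) →
    ∀ c ∈ hamiltonianCyclesThrough 5 3, (∀ x ∈ a, x ∉ c) → (∀ x ∈ b, x ∉ c) →
    ∀ d ∈ hamiltonianCyclesThrough 5 4, (∀ x ∈ a, x ∉ d) → (∀ x ∈ b, x ∉ d) → (∀ x ∈ c, x ∉ d) →
    ∀ e ∈ hamiltonianCyclesThrough 5 5, (∀ x ∈ a, x ∉ e) → (∀ x ∈ b, x ∉ e) → (∀ x ∈ c, x ∉ e) →
      ¬ ∀ x ∈ d, x ∉ e := by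
  decide +kernel

theorem not_isHamiltonianPacking_fin_four (f : Fin 3 → Fin 4 → Fin 4) :
    ¬ IsHamiltonianPacking f := by
  intro hf
  obtain ⟨g, hg, hd⟩ := hf.exists_cycleThrough (by omega)
  exact no_disjoint_hamiltonianCyclesThrough_three _ (hg 1 (by omega) (by omega)) _
    (hg 2 (by omega) (by omega)) (hd _ _ (by omega) (by omega) (by omega) (by omega) (by omega)) _
    (hg 3 (by omega) (by omega)) (hd _ _ (by omega) (by omega) (by omega) (by omega) (by omega))
    (hd _ _ (by omega) (by omega) (by omega) (by omega) (by omega))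

theorem not_isHamiltonianPacking_fin_six (f : Fin 5 → Fin 6 → Fin 6) :
    ¬ IsHamiltonianPacking f := by
  intro hf
  obtain ⟨g, hg, hd⟩ := hf.exists_cycleThrough (by omega)
  have hd' : ∀ h h', 1 ≤ h → h < h' → h' ≤ 5 → ∀ x ∈ g h, x ∉ g h' := fun h h' h1 h2 h3 =>
    hd h h' h1 (by omega) (by omega) h3 h2.ne
  exact no_disjoint_hamiltonianCyclesThrough_five
    _ (hg 1 (by omega) (by omega))
    _ (hg 2 (by omega) (by omega)) (hd' 1 2 (by omega) (by omega) (by omega))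
    _ (hg 3 (by omega) (by omega)) (hd' 1 3 (by omega) (by omega) (by omega))
      (hd' 2 3 (by omega) (by omega) (by omega))
    _ (hg 4 (by omega) (by omega)) (hd' 1 4 (by omega) (by omega) (by omega))
      (hd' 2 4 (by omega) (by omega) (by omega)) (hd' 3 4 (by omega) (by omega) (by omega))
    _ (hg 5 (by omega) (by omega)) (hd' 1 5 (by omega) (by omega) (by omega))
      (hd' 2 5 (by omega) (by omega) (by omega)) (hd' 3 5 (by omega) (by omega) (by omega))
      (hd' 4 5 (by omega) (by omega) (by omega))

/-! ### Lower bound: Hamiltonian cycles of `S` and stars -/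

namespace Digraph

variable {V : Type*}

theorem isInternallyDisjointFamily_of_fintype {κ : Type*} [Fintype κ] {D : Digraph V}
    {S : Finset V} (H : κ → D.Subgraph) (h₁ : ∀ i, (H i).IsStrong)
    (h₂ : ∀ i, (S : Set V) ⊆ (H i).verts)
    (h₃ : ∀ i j, i ≠ j → (H i).verts ∩ (H j).verts ⊆ S)
    (h₄ : ∀ i j u v, (H i).Adj u v → (H j).Adj u v → i = j) :
    ∃ H : Fin (Fintype.card κ) → D.Subgraph, D.IsInternallyDisjointFamily S H := by
  let e := (Fintype.equivFin κ).symm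
  refine ⟨fun i => H (e i), fun i => h₁ _, fun i => h₂ _, fun i j hij => ?_, fun i j hij => ?_⟩
  · exact (h₃ _ _ (e.injective.ne hij.ne)).antisymm (Set.subset_inter (h₂ _) (h₂ _))
  · rw [Set.eq_empty_iff_forall_notMem]
    rintro ⟨u, v⟩ ⟨h, h'⟩
    exact hij.ne (e.injective (h₄ _ _ u v h h'))

theorem completeBiorientation_top_adj {u v : V} :
    (⊤ : SimpleGraph V).completeBiorientation.Adj u v ↔ u ≠ v := Iff.rfl

/-- The subgraph on `S` given by the arcs of a fixed-point-free self-map of `S`. -/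
def Subgraph.ofMap {S : Finset V} (f : S → S) (hf : ∀ v, f v ≠ v) :
    (⊤ : SimpleGraph V).completeBiorientation.Subgraph where
  verts := S
  Adj u v := ∃ a : S, (a : V) = u ∧ (f a : V) = v
  adj_sub := by
    rintro _ _ ⟨a, rfl, rfl⟩
    exact fun h => hf a (Subtype.ext h.symm)
  left_mem := by
    rintro _ _ ⟨a, rfl, rfl⟩
    exact a.2
  right_mem := by
    rintro _ _ ⟨a, rfl, rfl⟩
    exact (f a).2

/-- The star with centre `t` and leaves `S`, with all arcs in both directions. -/
def Subgraph.star (S : Finset V) {t : V} (ht : t ∉ S) :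
    (⊤ : SimpleGraph V).completeBiorientation.Subgraph where
  verts := Insert.insert t (S : Set V)
  Adj u v := (u = t ∧ v ∈ S) ∨ (u ∈ S ∧ v = t)
  adj_sub := by
    rintro u v (⟨rfl, hv⟩ | ⟨hu, rfl⟩)
    · exact fun h => ht (h ▸ hv)
    · exact fun h => ht (h ▸ hu)
  left_mem := by
    rintro u v (⟨rfl, hv⟩ | ⟨hu, rfl⟩) <;> simp [*]
  right_mem := by
    rintro u v (⟨rfl, hv⟩ | ⟨hu, rfl⟩) <;> simp [*]

theorem Subgraph.isStrong_ofMap {S : Finset V} (hS : S.Nonempty) {f : S → S} (hf : ∀ v, f v ≠ v)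
    (hh : IsHamiltonianMap f) : (Subgraph.ofMap f hf).IsStrong := by
  refine ⟨hS, fun u hu v hv => ?_⟩
  exact Relation.ReflTransGen.lift (r := fun a b => f a = b)
    (p := (Subgraph.ofMap f hf).Adj) Subtype.val (by rintro a b rfl; exact ⟨a, rfl, rfl⟩) _ _
    (hh ⟨u, hu⟩ ⟨v, hv⟩)

theorem Subgraph.isStrong_star (S : Finset V) {t : V} (ht : t ∉ S) :
    (Subgraph.star S ht).IsStrong := by
  refine ⟨⟨t, by simp [Subgraph.star]⟩, fun u hu v hv => ?_⟩
  have h₁ : Relation.ReflTransGen (Subgraph.star S ht).Adj u t := by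
    rcases hu with rfl | hu
    · exact .refl
    · exact .single (.inr ⟨hu, rfl⟩)
  rcases hv with rfl | hv
  · exact h₁
  · exact h₁.tail (.inl ⟨rfl, hv⟩)

/-- Hamiltonian cycles of `S` together with the stars centred outside `S`. -/
theorem exists_isInternallyDisjointFamily [Fintype V] {S : Finset V} (hS : S.Nonempty)
    {m : ℕ} {f : Fin m → S → S} (hf : IsHamiltonianPacking f) :
    ∃ H : Fin (m + (Fintype.card V - S.card)) →
        (⊤ : SimpleGraph V).completeBiorientation.Subgraph,
      IsInternallyDisjointFamily _ S H := by
  classical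
  have hcard : Fintype.card (Fin m ⊕ {t // t ∉ S}) = m + (Fintype.card V - S.card) := by
    rw [Fintype.card_sum, Fintype.card_fin, Fintype.card_subtype_compl, Fintype.card_coe]
  rw [← hcard]
  refine isInternallyDisjointFamily_of_fintype
    (Sum.elim (fun i => Subgraph.ofMap (f i) (hf.ne_self i)) fun t => Subgraph.star S t.2)
    ?_ ?_ ?_ ?_
  · rintro (i | t)
    · exact Subgraph.isStrong_ofMap hS (hf.ne_self i) (hf.hamiltonian i)
    · exact Subgraph.isStrong_star S t.2
  · rintro (i | t)
    · exact subset_rfl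
    · exact Set.subset_insert _ _
  · rintro (i | t) (j | t') hne
    · exact Set.inter_subset_left
    · exact Set.inter_subset_left
    · exact Set.inter_subset_right
    · rintro v ⟨rfl | hv, hv'⟩
      · rcases hv' with h | hv'
        · exact absurd (congrArg Sum.inr (Subtype.ext h)) hne
        · exact hv'
      · exact hv
  -- Cycle arcs have both ends in `S`, while a star arc has exactly one end outside `S`, namely the
  -- centre, which identifies the star.
  · rintro (i | ⟨t, ht⟩) (j | ⟨t', ht'⟩) u v h h'
    · obtain ⟨a, rfl, rfl⟩ := h
      obtain ⟨b, hb, hb'⟩ := h'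
      obtain rfl : b = a := Subtype.ext hb
      exact congrArg Sum.inl (hf.injective b (Subtype.ext hb'.symm))
    · obtain ⟨a, rfl, rfl⟩ := h
      rcases h' with ⟨h, -⟩ | ⟨-, h⟩
      · exact absurd ((show (a : V) = t' from h) ▸ a.2) ht'
      · exact absurd ((show (f i a : V) = t' from h) ▸ (f i a).2) ht'
    · obtain ⟨a, rfl, rfl⟩ := h'
      rcases h with ⟨h, -⟩ | ⟨-, h⟩
      · exact absurd ((show (a : V) = t from h) ▸ a.2) ht
      · exact absurd ((show (f j a : V) = t from h) ▸ (f j a).2) ht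
    · rcases h with ⟨rfl, hv⟩ | ⟨hu, rfl⟩ <;> rcases h' with ⟨h, h'⟩ | ⟨h, h'⟩
      · subst h; rfl
      · exact absurd h ht
      · exact absurd h' ht
      · subst h'; rfl

/-! ### Upper bound and the case of equality -/

namespace IsInternallyDisjointFamily

variable {D : Digraph V} {S : Finset V} {p : ℕ} {H : Fin p → D.Subgraph}

theorem eq_of_adj (hH : D.IsInternallyDisjointFamily S H) {i j : Fin p} {u v : V}
    (hi : (H i).Adj u v) (hj : (H j).Adj u v) : i = j := by
  rcases lt_trichotomy i j with h | h | h
  · exact absurd (show (u, v) ∈ (H i).arcs ∩ (H j).arcs from ⟨hi, hj⟩)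
      (by rw [hH.arcs_inter i j h]; exact id)
  · exact h
  · exact absurd (show (u, v) ∈ (H j).arcs ∩ (H i).arcs from ⟨hj, hi⟩)
      (by rw [hH.arcs_inter j i h]; exact id)

theorem eq_of_mem_verts (hH : D.IsInternallyDisjointFamily S H) {i j : Fin p} {v : V}
    (hv : v ∉ S) (hi : v ∈ (H i).verts) (hj : v ∈ (H j).verts) : i = j := by
  rcases lt_trichotomy i j with h | h | h
  · exact absurd (show v ∈ (H i).verts ∩ (H j).verts from ⟨hi, hj⟩)
      (by rw [hH.verts_inter i j h]; exact hv)
  · exact h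
  · exact absurd (show v ∈ (H j).verts ∩ (H i).verts from ⟨hj, hi⟩)
      (by rw [hH.verts_inter j i h]; exact hv)

theorem exists_adj (hH : D.IsInternallyDisjointFamily S H) (hS : 2 ≤ S.card) (i : Fin p) {v : V}
    (hv : v ∈ S) : ∃ w, (H i).Adj v w := by
  obtain ⟨w, hw, hne⟩ := Finset.exists_mem_ne hS v
  rcases ((hH.isStrong i).2 v (hH.subset_verts i hv) w
    (hH.subset_verts i hw)).cases_head with h | ⟨c, hc, -⟩
  · exact absurd h.symm hne
  · exact ⟨c, hc⟩

end IsInternallyDisjointFamily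

section Upper

variable [Fintype V] {S : Finset V} {p : ℕ}
  {H : Fin p → (⊤ : SimpleGraph V).completeBiorientation.Subgraph}

/-- Strongness forces an out-arc in every subgraph at a fixed vertex of `S`, and arc-disjointness
makes their heads distinct. -/
theorem IsInternallyDisjointFamily.le_card_sub_one (hH : IsInternallyDisjointFamily _ S H)
    (hS : 2 ≤ S.card) : p ≤ Fintype.card V - 1 := by
  classical
  obtain ⟨v, hv⟩ : S.Nonempty := Finset.card_pos.1 (by omega)
  choose out hout using fun i => hH.exists_adj hS i hv
  have hinj : Function.Injective fun i =>
      (⟨out i, (completeBiorientation_top_adj.1 ((H i).adj_sub (hout i))).symm⟩ : {w // w ≠ v}) :=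
    fun i j h => hH.eq_of_adj (hout i)
      ((show out i = out j from congrArg Subtype.val h) ▸ hout j)
  simpa using Fintype.card_le_of_injective _ hinj

/-- If the trivial upper bound is attained, then every subgraph in the family has out-degree one
on `S`. -/
theorem IsInternallyDisjointFamily.adj_unique (hH : IsInternallyDisjointFamily _ S H)
    (hS : 2 ≤ S.card) (hp : p = Fintype.card V - 1) {i : Fin p} {v w w' : V} (hv : v ∈ S)
    (hw : (H i).Adj v w) (hw' : (H i).Adj v w') : w = w' := by
  classical
  choose out hout using fun j => hH.exists_adj hS j hv
  -- One out-arc at `v` from each of the `n - 1` subgraphs already exhausts the out-arcs at `v`, so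
  -- no subgraph has a second one.
  have hne : ∀ {j x}, (H j).Adj v x → x ≠ v := fun h =>
    (completeBiorientation_top_adj.1 ((H _).adj_sub h)).symm
  have hbij : Function.Bijective fun j => (⟨out j, hne (hout j)⟩ : {w // w ≠ v}) := by
    rw [Fintype.bijective_iff_injective_and_card]
    exact ⟨fun i j h => hH.eq_of_adj (hout i)
      ((show out i = out j from congrArg Subtype.val h) ▸ hout j), by simpa using hp⟩
  have key : ∀ {x}, (H i).Adj v x → x = out i := by
    intro x hx
    obtain ⟨j, hj⟩ := hbij.2 ⟨x, hne hx⟩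
    have hj' : out j = x := congrArg Subtype.val hj
    rw [hH.eq_of_adj hx (hj' ▸ hout j), hj']
  rw [key hw, key hw']

/-- If the trivial upper bound is attained, then the subgraphs with vertex set `S` form a packing
of at least `S.card - 1` Hamiltonian cycles of `S`. -/
theorem IsInternallyDisjointFamily.exists_isHamiltonianPacking
    (hH : IsInternallyDisjointFamily _ S H) (hS : 2 ≤ S.card) (hp : p = Fintype.card V - 1) :
    ∃ f : Fin (S.card - 1) → Fin S.card → Fin S.card, IsHamiltonianPacking f := by
  classical
  choose out hout using fun i (v : S) => hH.exists_adj hS i v.2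
  have hmem : ∀ (i : {i // (H i).verts = S}) v, out i v ∈ S := fun i v => by
    have := (H i).right_mem (hout i v)
    rwa [i.2] at this
  have hf : IsHamiltonianPacking fun (i : {i // (H i).verts = S}) (v : S) =>
      (⟨out i v, hmem i v⟩ : S) := by
    refine ⟨fun i u v => ?_, fun i v h => ?_, fun v i j h => ?_⟩
    · have huv := (hH.isStrong i).2 u (hH.subset_verts i u.2) v (hH.subset_verts i v.2)
      -- As the out-degree on `S` is one, every walk in `H i` starting in `S` follows the successor
      -- map `out i`.
      have key : ∀ w, Relation.ReflTransGen (H i).Adj u w → ∃ hw : w ∈ S, Relation.ReflTransGen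
          (fun a b => (⟨out i a, hmem i a⟩ : S) = b) u ⟨w, hw⟩ := by
        intro w hw
        induction hw with
        | refl => exact ⟨u.2, .refl⟩
        | @tail b c _ hbc ih =>
          obtain ⟨hb, ih⟩ := ih
          obtain rfl : out i ⟨b, hb⟩ = c := hH.adj_unique hS hp hb (hout i ⟨b, hb⟩) hbc
          exact ⟨hmem i ⟨b, hb⟩, ih.tail rfl⟩
      exact (key v huv).2
    · exact completeBiorientation_top_adj.1 ((H i).adj_sub (hout i v))
        (congrArg Subtype.val h).symm
    · have h' : out i v = out j v := congrArg Subtype.val h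
      exact Subtype.ext (hH.eq_of_adj (hout i v) (h' ▸ hout j v))
  have hex : ∀ i : {i // ¬ (H i).verts = S}, ∃ t : {t // t ∉ S}, t.1 ∈ (H i).verts := by
    rintro ⟨i, hi⟩
    by_contra! hcon
    exact hi (Set.Subset.antisymm
      (fun v hv => by_contra fun hvS => hcon ⟨v, hvS⟩ hv) (hH.subset_verts i))
  -- The chosen vertices outside `S` are distinct, so at most `n - k` subgraphs leave `S`, and at
  -- least `(n - 1) - (n - k) = k - 1` have vertex set `S`.
  choose t ht using hex
  have hle := Fintype.card_le_of_injective t fun i j h =>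
    Subtype.ext (hH.eq_of_mem_verts (t i).2 (ht i) (h ▸ ht j))
  rw [Fintype.card_subtype_compl, Fintype.card_subtype_compl, Fintype.card_coe,
    Fintype.card_fin] at hle
  have hSV := S.card_le_univ
  have hcard : Fintype.card (Fin (S.card - 1)) ≤
      Fintype.card {i // (H i).verts = S} := by
    rw [Fintype.card_fin]
    omega
  obtain ⟨d⟩ := Function.Embedding.nonempty_of_card_le hcard
  exact ⟨_, hf.congr S.equivFin d⟩

end Upper

/-! ### Evaluation of the connectivity -/

/-- The value depends on `S` only through its cardinality, so any `S` attaining the minimum over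
`k`-sets yields the final result. -/
theorem strongSubgraphConnectivityOn_completeBiorientation_top [Fintype V] {S : Finset V}
    (hS : 2 ≤ S.card) :
    (⊤ : SimpleGraph V).completeBiorientation.strongSubgraphConnectivityOn S =
      if S.card = 4 ∨ S.card = 6 then Fintype.card V - 2 else Fintype.card V - 1 := by
  have hgreat := isGreatest_strongSubgraphConnectivityOn
    (⊤ : SimpleGraph V).completeBiorientation S hS
  have hSV := S.card_le_univ
  have lower : ∀ {m : ℕ} {f : Fin m → Fin S.card → Fin S.card}, IsHamiltonianPacking f →
      m + (Fintype.card V - S.card) ≤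
        (⊤ : SimpleGraph V).completeBiorientation.strongSubgraphConnectivityOn S := fun hf =>
    hgreat.2 (exists_isInternallyDisjointFamily (Finset.card_pos.1 (by omega))
      (hf.congr S.equivFin.symm (.refl _)))
  obtain ⟨H, hH⟩ := hgreat.1
  have upper := hH.le_card_sub_one hS
  have strict := hH.exists_isHamiltonianPacking hS
  split_ifs with hk
  · rcases hk with hk | hk
    · rw [hk] at lower strict
      obtain ⟨f, hf⟩ := exists_isHamiltonianPacking_fin_four
      have := lower hf
      -- The equation is that of the maximum with `n - 1`, the hypothesis of `strict`; attaining it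
      -- would give a full decomposition on four vertices.
      have hne : ¬ _ = _ := fun h => (strict h).elim not_isHamiltonianPacking_fin_four
      omega
    · rw [hk] at lower strict
      obtain ⟨f, hf⟩ := exists_isHamiltonianPacking_fin_six
      have := lower hf
      have hne : ¬ _ = _ := fun h => (strict h).elim not_isHamiltonianPacking_fin_six
      omega
  · obtain ⟨f, hf⟩ := exists_isHamiltonianPacking_fin hS (fun h => hk (.inl h))
      fun h => hk (.inr h)
    have := lower hf
    omega

end Digraph

theorem mainTheorem7 (n k : ℕ) (hk : 2 ≤ k) (hkn : k ≤ n) :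
    (⊤ : SimpleGraph (Fin n)).completeBiorientation.strongSubgraphConnectivity k =
      if k = 4 ∨ k = 6 then n - 2 else n - 1 := by
  obtain ⟨S, rfl, hS⟩ := (Digraph.isLeast_strongSubgraphConnectivity
    (⊤ : SimpleGraph (Fin n)).completeBiorientation k (by simpa using hkn)).1
  rw [← hS, Digraph.strongSubgraphConnectivityOn_completeBiorientation_top hk, Fintype.card_fin]
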